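/- Let $B$ be the adjacency matrix of the Petersen graph, with respect to any labelling of its vertices, and let $\mathbb{Z}[B]=\{f(B)\mid f\in\mathbb{Z}[x]\}$ be the subring of $M_{10}(\mathbb{Z})$ generated by $B$. The set of eigenvalues of $B$ is $\{3,1,-2\}$. For every $n\ge 1$ the ring $\mathbb{Z}[B]$ has only finitely many ideals of index $n$; let $a_n$ be their number and let $\zeta_{\mathbb{Z}[B]}(s)=\sum_{n\ge 1}a_n n^{-s}$. Then \[\zeta_{\mathbb{Z}[B]}(s)=\prod_{p\in\{2,3,5\}}\left(1-p^{-s}+p^{1-2s}\right)\cdot\zeta(s)^3,\] where $\zeta(s)=\sum_{n\ge 1}n^{-s}$ is the Riemann zeta function. The identity holds for formal Dirichlet series, and, for every complex $s$ with $\operatorname{Re}(s)>1$, the series $\sum_{n\ge 1} a_n n^{-s}$ converges absolutely and the identity holds for its value. -/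

import Mathlib

/-- The Petersen graph: its vertices are the ten two-element subsets of a five-element set, and two
of them are adjacent exactly when they are disjoint. -/
def petersenGraph : SimpleGraph {s : Finset (Fin 5) // s.card = 2} where
  Adj s t := Disjoint s.1 t.1
  symm := ⟨fun _ _ h => h.symm⟩
  loopless := ⟨fun s h => by
    have h0 : s.1 = ∅ := by simpa using h
    have h2 := s.2
    simp [h0] at h2⟩

/-- The ring `ℤ[B]`: the subring of the full matrix ring over `ℤ` generated by `B`. -/
abbrev matrixOrder {V : Type*} [Fintype V] [DecidableEq V] (B : Matrix V V ℤ) :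
    Subalgebra ℤ (Matrix V V ℤ) :=
  Algebra.adjoin ℤ {B}

/-- `ℤ[B]` consists of the integral polynomials in `B`. -/
theorem mem_matrixOrder_iff {V : Type*} [Fintype V] [DecidableEq V] (B C : Matrix V V ℤ) :
    C ∈ matrixOrder B ↔ ∃ f : Polynomial ℤ, Polynomial.aeval B f = C := by
  rw [matrixOrder, Algebra.adjoin_singleton_eq_range_aeval, AlgHom.mem_range]

instance matrixOrder.instCommRing {V : Type*} [Fintype V] [DecidableEq V] (B : Matrix V V ℤ) :
    CommRing (matrixOrder B) :=
  { (inferInstance : Ring (matrixOrder B)) with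
    mul_comm := by
      rintro ⟨x, hx⟩ ⟨y, hy⟩
      obtain ⟨f, rfl⟩ := (mem_matrixOrder_iff B x).1 hx
      obtain ⟨g, rfl⟩ := (mem_matrixOrder_iff B y).1 hy
      apply Subtype.ext
      change Polynomial.aeval B f * Polynomial.aeval B g =
        Polynomial.aeval B g * Polynomial.aeval B f
      rw [← map_mul, ← map_mul, mul_comm] }

/-- The ideals of `R` whose index, as additive subgroups of `R`, is `n`. -/
def idealsOfIndex (R : Type*) [CommRing R] (n : ℕ) : Set (Ideal R) :=
  {I | I.toAddSubgroup.index = n}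

/-- The formal Dirichlet series `∑_{n ≥ 1} a_n n^{-s}` of a commutative ring `R`, where `a_n` is the
number of ideals of `R` of index `n`. It is recorded as the sequence of its coefficients; their
sum and product in `ArithmeticFunction` are those of formal Dirichlet series. -/
noncomputable def idealZeta (R : Type*) [CommRing R] : ArithmeticFunction ℤ where
  toFun n := if n = 0 then 0 else ((idealsOfIndex R n).ncard : ℤ)
  map_zero' := if_pos rfl

/-- The formal Dirichlet series `1 - p^{-s} + p^{1-2s} = 1 - p^{-s} + p * (p^{-s})^2`, that is, the
polynomial `1 - X + p X ^ 2` at `X = p^{-s}`. -/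
noncomputable def localFactor (p : ℕ) : ArithmeticFunction ℤ :=
  ArithmeticFunction.ofPowerSeries p
    (1 - PowerSeries.X + PowerSeries.C (p : ℤ) * PowerSeries.X ^ 2)

/-! Put `y = B + 2`, with eigenvalues `0, 3, 5`, so that `y * (y - 3) * (y - 5) = 0`. The Newton
basis `1, y, y * (y - 3)` identifies `ℤ[B]` with `ℤ³` and makes multiplication by `y` triangular:
`(r₀, r₁, r₂) ↦ (0, r₀ + 3 * r₁, r₁ + 5 * r₂)`. Ideals are thus the subgroups of `ℤ³` stable under
this map. A subgroup of finite index has a unique Hermite normal form with diagonal `a, d, g` and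
index `a * d * g`. Stability amounts to three linear congruences
(`isShiftStable_hermiteLattice_iff`), whose leading coefficients `2, 3, 5` are the differences of
the eigenvalues. The number of solutions is a product of three weights, one for each prime and each
pair of diagonal entries (`card_stableHermiteEntries`). Summing over `a * d * g = n` without weights
gives `ζ(s)^3`; the weight at `p` contributes exactly the factor `1 - p^{-s} + p^{1-2s}`
(`factorizationSum_congruenceWeight_mul`). Convergence for `Re s > 1` is that of `ζ`, the other
factors being finite sums. -/

/-! ### Formal Dirichlet series of weighted factorizations. -/

theorem ArithmeticFunction.nsmul_apply_int (m : ℕ) (F : ArithmeticFunction ℤ) (n : ℕ) :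
    (m • F) n = m * F n := by
  induction m with
  | zero => simp
  | succ m ih =>
    rw [succ_nsmul, ArithmeticFunction.add_apply, ih]
    push_cast
    ring

/-- The sum of `W x` over all factorizations `∏ i, x i = n`, as a function of `n`. -/
def factorizationSum (k : ℕ) (W : (Fin k → ℕ) → ℤ) : ArithmeticFunction ℤ where
  toFun n := ∑ x ∈ Nat.finMulAntidiag k n, W x
  map_zero' := by simp

theorem factorizationSum_apply (k : ℕ) (W : (Fin k → ℕ) → ℤ) (n : ℕ) :
    factorizationSum k W n = ∑ x ∈ Nat.finMulAntidiag k n, W x := rfl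

/-- The formal Dirichlet series `p^{-s}`. -/
noncomputable def dirichletMonomial (p : ℕ) : ArithmeticFunction ℤ :=
  ArithmeticFunction.ofPowerSeries p PowerSeries.X

theorem dirichletMonomial_apply {p : ℕ} (hp : 1 < p) (n : ℕ) :
    dirichletMonomial p n = if n = p then 1 else 0 := by
  rw [dirichletMonomial, ArithmeticFunction.ofPowerSeries_apply hp]
  by_cases h : ∃ k, p ^ k = n
  · obtain ⟨k, rfl⟩ := h
    rw [(Nat.pow_right_injective hp).extend_apply, PowerSeries.coeff_X]
    congr 1
    rw [eq_iff_iff]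
    conv_rhs => rhs; rw [← pow_one p]
    exact (Nat.pow_right_injective hp).eq_iff.symm
  · rw [Function.extend_apply' _ _ _ h, if_neg]
    · rfl
    · rintro rfl
      exact h ⟨1, pow_one n⟩

theorem localFactor_eq (p : ℕ) :
    localFactor p =
      1 - dirichletMonomial p + (p : ArithmeticFunction ℤ) * dirichletMonomial p ^ 2 := by
  rw [localFactor, dirichletMonomial, map_add, map_sub, map_one, map_mul, map_pow]
  congr 2
  simp

theorem dirichletMonomial_mul_apply {p : ℕ} (hp : 1 < p) (F : ArithmeticFunction ℤ) (n : ℕ) :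
    (dirichletMonomial p * F) n = if p ∣ n then F (n / p) else 0 := by
  rcases eq_or_ne n 0 with rfl | hn
  · simp
  rw [ArithmeticFunction.mul_apply]
  simp_rw [dirichletMonomial_apply hp, ite_mul, one_mul, zero_mul]
  split_ifs with h
  · rw [Finset.sum_eq_single (p, n / p)]
    · simp
    · rintro ⟨a, b⟩ hab hne
      rw [if_neg]
      rintro rfl
      simp only [Nat.mem_divisorsAntidiagonal] at hab
      apply hne
      rw [← hab.1, Nat.mul_div_cancel_left _ (by omega)]
    · intro hx
      exact absurd (Nat.mem_divisorsAntidiagonal.2 ⟨Nat.mul_div_cancel' h, hn⟩) hx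
  · apply Finset.sum_eq_zero
    rintro ⟨a, b⟩ hab
    rw [if_neg]
    rintro rfl
    exact h ⟨b, (Nat.mem_divisorsAntidiagonal.1 hab).1.symm⟩

/-- Substitute `p * c` for the `i`-th factor: this divides the total product by `p`, which is
multiplication of the series by `p^{-s}`. -/
theorem factorizationSum_dvd {k p : ℕ} (hp : 1 < p) (i : Fin k) (W : (Fin k → ℕ) → ℤ) :
    factorizationSum k (fun x => if p ∣ x i then W x else 0) =
      dirichletMonomial p * factorizationSum k (fun x => W ((Pi.mulSingle i p : Fin k → ℕ) * x)) := by
  ext n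
  rw [dirichletMonomial_mul_apply hp, factorizationSum_apply, ← Finset.sum_filter]
  have hprod (x : Fin k → ℕ) : ∏ j, ((Pi.mulSingle i p : Fin k → ℕ) * x) j = p * ∏ j, x j := by
    simp only [Pi.mul_apply, Finset.prod_mul_distrib]
    simp
  split_ifs with h
  · obtain ⟨m, rfl⟩ := h
    rw [Nat.mul_div_cancel_left _ (by omega), factorizationSum_apply]
    symm
    refine Finset.sum_bij (fun x _ => (Pi.mulSingle i p : Fin k → ℕ) * x) ?_ ?_ ?_ (fun _ _ => rfl)
    · intro x hx
      rw [Nat.mem_finMulAntidiag] at hx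
      rw [Finset.mem_filter, Nat.mem_finMulAntidiag, hprod, hx.1]
      refine ⟨⟨rfl, mul_ne_zero (by omega) hx.2⟩, ?_⟩
      simp
    · intro x _ y _ hxy
      ext j
      have := congrFun hxy j
      simp only [Pi.mul_apply] at this
      refine Nat.eq_of_mul_eq_mul_left ?_ this
      rcases eq_or_ne j i with rfl | hj
      · simp; omega
      · simp [hj]
    · intro y hy
      rw [Finset.mem_filter, Nat.mem_finMulAntidiag] at hy
      obtain ⟨⟨h1, h2⟩, c, hc⟩ := hy
      have hy' : (Pi.mulSingle i p : Fin k → ℕ) * Function.update y i c = y := by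
        ext j
        rcases eq_or_ne j i with rfl | hj
        · simp [hc]
        · simp [hj]
      refine ⟨Function.update y i c, ?_, hy'⟩
      rw [Nat.mem_finMulAntidiag]
      refine ⟨?_, fun h0 => h2 (by simp [h0])⟩
      rw [← hy', hprod] at h1
      exact Nat.eq_of_mul_eq_mul_left (by omega) h1
  · apply Finset.sum_eq_zero
    intro x hx
    rw [Finset.mem_filter, Nat.mem_finMulAntidiag] at hx
    exact absurd (hx.2.trans (hx.1.1 ▸ Finset.dvd_prod_of_mem x (Finset.mem_univ i))) h

/-- The number of `b` modulo `d` with `a + p * b ≡ 0` modulo `d`, for a prime number `p`. -/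
def congruenceWeight (p : ℕ) (a d : ℤ) : ℤ :=
  if (p : ℤ) ∣ d then if (p : ℤ) ∣ a then p else 0 else 1

/-- The weight is `1 - [p ∣ x j] + p * [p ∣ x i] * [p ∣ x j]`. As `W` does not see factors `p` in
positions `i` and `j`, each divisibility condition extracts one `p^{-s}`. -/
theorem factorizationSum_congruenceWeight_mul {k p : ℕ} (hp : 1 < p) (i j : Fin k) (hij : i ≠ j)
    (W : (Fin k → ℕ) → ℤ) (hi : ∀ x, W ((Pi.mulSingle i p : Fin k → ℕ) * x) = W x)
    (hj : ∀ x, W ((Pi.mulSingle j p : Fin k → ℕ) * x) = W x) :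
    factorizationSum k (fun x => congruenceWeight p (x i) (x j) * W x) =
      localFactor p * factorizationSum k W := by
  have h1 : factorizationSum k (fun x => if p ∣ x j then W x else 0) =
      dirichletMonomial p * factorizationSum k W := by
    rw [factorizationSum_dvd hp j]
    simp_rw [hj]
  have h2 : factorizationSum k (fun x => if p ∣ x i then if p ∣ x j then W x else 0 else 0) =
      dirichletMonomial p ^ 2 * factorizationSum k W := by
    rw [factorizationSum_dvd hp i, pow_two, mul_assoc, ← h1]
    simp_rw [hi]
    simp [hij.symm]
  have h3 : factorizationSum k (fun x => congruenceWeight p (x i) (x j) * W x) =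
      factorizationSum k W - factorizationSum k (fun x => if p ∣ x j then W x else 0) +
      p • factorizationSum k (fun x => if p ∣ x i then if p ∣ x j then W x else 0 else 0) := by
    ext n
    rw [ArithmeticFunction.add_apply, ArithmeticFunction.nsmul_apply_int, sub_eq_add_neg,
      ArithmeticFunction.add_apply]
    change _ = _ + -(factorizationSum k (fun x => if p ∣ x j then W x else 0) n) + _
    simp only [factorizationSum_apply]
    rw [Finset.mul_sum, ← sub_eq_add_neg, ← Finset.sum_sub_distrib, ← Finset.sum_add_distrib]
    refine Finset.sum_congr rfl fun x _ => ?_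
    simp only [congruenceWeight, Int.natCast_dvd_natCast]
    split_ifs <;> ring
  rw [h3, h1, h2, localFactor_eq, nsmul_eq_mul]
  ring

theorem factorizationSum_three_one :
    factorizationSum 3 (fun _ => 1) = (ArithmeticFunction.zeta : ArithmeticFunction ℤ) ^ 3 := by
  ext n
  have h3 : (ArithmeticFunction.zeta : ArithmeticFunction ℤ) ^ 3 =
    (ArithmeticFunction.zeta : ArithmeticFunction ℤ) * ((ArithmeticFunction.zeta :
      ArithmeticFunction ℤ) * (ArithmeticFunction.zeta : ArithmeticFunction ℤ)) := by ring
  rw [h3, ArithmeticFunction.coe_zeta_mul_apply]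
  simp_rw [ArithmeticFunction.coe_zeta_mul_apply]
  rcases eq_or_ne n 0 with rfl | hn
  · simp
  have h1 : ∀ m ∈ n.divisors, ∑ i ∈ m.divisors,
      (ArithmeticFunction.zeta : ArithmeticFunction ℤ) i = ∑ i ∈ m.divisors, 1 := by
    intro m _
    refine Finset.sum_congr rfl fun i hi => ?_
    have := (Nat.pos_of_mem_divisors hi).ne'
    simp [this]
  rw [Finset.sum_congr rfl h1, Finset.sum_sigma', factorizationSum_apply]
  -- The iterated divisor sum counts chains `a ∣ m ∣ n`; a factorization gives the chain of its
  -- partial products.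
  refine Finset.sum_bij (fun x _ => ⟨x 0 * x 1, x 0⟩) ?_ ?_ ?_ (fun _ _ => rfl)
  · intro x hx
    have hx0 := Nat.ne_zero_of_mem_finMulAntidiag hx
    simp only [Finset.mem_sigma, Nat.mem_divisors]
    exact ⟨⟨⟨x 2, (Nat.finMulAntidiag_three x hx).symm⟩, hn⟩, dvd_mul_right _ _,
      mul_ne_zero (hx0 0) (hx0 1)⟩
  · intro x hx y hy hxy
    have hx0 := Nat.ne_zero_of_mem_finMulAntidiag hx
    have hy0 := Nat.ne_zero_of_mem_finMulAntidiag hy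
    have hx3 := Nat.finMulAntidiag_three x hx
    have hy3 := Nat.finMulAntidiag_three y hy
    simp only [Sigma.mk.injEq, heq_eq_eq] at hxy
    have e1 : x 1 = y 1 := by
      have := hxy.1
      rw [hxy.2] at this
      exact Nat.eq_of_mul_eq_mul_left (Nat.pos_of_ne_zero (hy0 0)) this
    have e2 : x 2 = y 2 := by
      rw [← hx3, hxy.1] at hy3
      exact (Nat.eq_of_mul_eq_mul_left
        (Nat.pos_of_ne_zero (mul_ne_zero (hy0 0) (hy0 1))) hy3).symm
    ext j
    fin_cases j
    exacts [hxy.2, e1, e2]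
  · rintro ⟨m, a⟩ hm
    simp only [Finset.mem_sigma, Nat.mem_divisors] at hm
    obtain ⟨⟨⟨g, hg⟩, -⟩, ⟨d, hd⟩, -⟩ := hm
    refine ⟨![a, d, g], ?_, ?_⟩
    · rw [Nat.mem_finMulAntidiag]
      subst hg hd
      simpa [Fin.prod_univ_three, and_assoc] using hn
    · simp [hd]

theorem congruenceWeight_mulSingle_mul {k p q : ℕ} (h : Nat.Coprime p q) (i j l : Fin k)
    (x : Fin k → ℕ) :
    congruenceWeight p (((Pi.mulSingle l q : Fin k → ℕ) * x) i : ℕ)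
      (((Pi.mulSingle l q : Fin k → ℕ) * x) j : ℕ) =
      congruenceWeight p (x i) (x j) := by
  have (m : Fin k) : p ∣ ((Pi.mulSingle l q : Fin k → ℕ) * x) m ↔ p ∣ x m := by
    rcases eq_or_ne m l with rfl | hm
    · simp [h.dvd_mul_left]
    · simp [hm]
  simp only [congruenceWeight, Int.natCast_dvd_natCast, this]

/-- The weights are peeled off one prime at a time; those remaining are unaffected because they
belong to other primes. -/
theorem factorizationSum_congruenceWeight_eq :
    factorizationSum 3 (fun x => congruenceWeight 2 (x 1) (x 2) *
      (congruenceWeight 3 (x 0) (x 1) * congruenceWeight 5 (x 0) (x 2))) =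
      (∏ p ∈ ({2, 3, 5} : Finset ℕ), localFactor p) *
        (ArithmeticFunction.zeta : ArithmeticFunction ℤ) ^ 3 := by
  have h32 : Nat.Coprime 3 2 := by norm_num
  have h52 : Nat.Coprime 5 2 := by norm_num
  have h53 : Nat.Coprime 5 3 := by norm_num
  have e5 := factorizationSum_congruenceWeight_mul (k := 3) (p := 5) (by norm_num) 0 2 (by decide)
    (fun _ => 1) (fun _ => rfl) (fun _ => rfl)
  simp only [mul_one] at e5
  rw [factorizationSum_congruenceWeight_mul (by norm_num) 1 2 (by decide),
    factorizationSum_congruenceWeight_mul (by norm_num) 0 1 (by decide), e5,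
    factorizationSum_three_one, Finset.prod_insert (by decide), Finset.prod_insert (by decide),
    Finset.prod_singleton]
  · ring
  all_goals intro x
  · exact congruenceWeight_mulSingle_mul h53 _ _ _ _
  · exact congruenceWeight_mulSingle_mul h53 _ _ _ _
  · rw [congruenceWeight_mulSingle_mul h32, congruenceWeight_mulSingle_mul h52]
  · rw [congruenceWeight_mulSingle_mul h32, congruenceWeight_mulSingle_mul h52]

/-! ### Counting solutions of linear congruences. -/

theorem sum_range_ite_dvd_add {d : ℕ} (hd : 0 < d) (k : ℤ) :
    ∑ b ∈ Finset.range d, (if (d : ℤ) ∣ k + b then (1 : ℤ) else 0) = 1 := by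
  have hd' : (0 : ℤ) < d := by exact_mod_cast hd
  have h0 := Int.emod_nonneg (-k) hd'.ne'
  have h1 := Int.emod_lt_of_pos (-k) hd'
  rw [Finset.sum_eq_single ((-k) % d).toNat]
  · rw [if_pos]
    rw [Int.toNat_of_nonneg h0, Int.emod_def]
    exact ⟨-(-k / d), by ring⟩
  · intro b hb hne
    rw [if_neg]
    rintro ⟨q, hq⟩
    apply hne
    have hb' : (b : ℤ) < d := by exact_mod_cast Finset.mem_range.1 hb
    have : (-k) % d = b := by
      rw [show -k = b + d * (-q) by linarith, Int.add_mul_emod_self_left]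
      exact Int.emod_eq_of_lt (by positivity) hb'
    rw [this, Int.toNat_natCast]
  · intro h
    exact absurd (Finset.mem_range.2 (by omega)) h

theorem sum_range_mul_ite_dvd_add (m : ℕ) {d : ℕ} (hd : 0 < d) (k : ℤ) :
    ∑ b ∈ Finset.range (m * d), (if (d : ℤ) ∣ k + b then (1 : ℤ) else 0) = m := by
  induction m with
  | zero => simp
  | succ m ih =>
    rw [Nat.succ_mul, Finset.sum_range_add, ih]
    have : ∀ b : ℕ, ((d : ℤ) ∣ k + ((m * d + b : ℕ) : ℤ)) ↔ (d : ℤ) ∣ k + b := fun b => by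
      rw [show k + ((m * d + b : ℕ) : ℤ) = (k + b) + d * m by push_cast; ring]
      exact dvd_add_left (dvd_mul_right _ _)
    simp_rw [this]
    rw [sum_range_ite_dvd_add hd]
    push_cast
    ring

theorem sum_range_ite_dvd_add_prime_mul {p d : ℕ} (hp : p.Prime) (hd : 0 < d) (k : ℤ) :
    ∑ b ∈ Finset.range d, (if (d : ℤ) ∣ k + p * b then (1 : ℤ) else 0) = congruenceWeight p k d := by
  rw [congruenceWeight]
  split_ifs with h1 h2
  -- Dividing by `p` leaves a congruence modulo `e = d / p` with one solution in each of the `p`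
  -- blocks of length `e`.
  · obtain ⟨e, rfl⟩ := Int.natCast_dvd_natCast.1 h1
    obtain ⟨l, rfl⟩ := h2
    have hp0 : (p : ℤ) ≠ 0 := by exact_mod_cast hp.ne_zero
    have : ∀ b : ℕ, (((p * e : ℕ) : ℤ) ∣ p * l + p * b) ↔ (e : ℤ) ∣ l + b := fun b => by
      rw [← mul_add, Nat.cast_mul]
      exact mul_dvd_mul_iff_left hp0
    simp_rw [this]
    exact sum_range_mul_ite_dvd_add p (Nat.pos_of_mul_pos_left hd) l
  · refine Finset.sum_eq_zero fun b _ => if_neg fun h => h2 ?_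
    exact (dvd_add_left (dvd_mul_right _ _)).1 (h1.trans h)
  · have hc : IsCoprime (p : ℤ) d := by
      rw [Nat.isCoprime_iff_coprime]
      exact (hp.coprime_iff_not_dvd).2 fun h => h1 (Int.natCast_dvd_natCast.2 h)
    -- Here `u` inverts `p` modulo `d`, so the coefficient of `b` can be made `1`.
    obtain ⟨u, v, huv⟩ := hc
    have : ∀ b : ℕ, ((d : ℤ) ∣ k + p * b) ↔ (d : ℤ) ∣ u * k + b := fun b => by
      constructor
      · rintro ⟨q, hq⟩
        exact ⟨u * q + v * b, by linear_combination u * hq - b * huv⟩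
      · rintro ⟨q, hq⟩
        exact ⟨p * q + v * k, by linear_combination p * hq - k * huv⟩
    simp_rw [this]
    exact sum_range_ite_dvd_add hd _

/-! ### Hermite normal forms of subgroups of `ℤ³`. -/

/-- The index of a subgroup of a product is the product of the indices of the two subgroups it
induces on the factors. -/
theorem AddSubgroup.index_eq_index_comap_inr_mul_index_map_fst {M N : Type*} [AddCommGroup M]
    [AddCommGroup N] (L : AddSubgroup (M × N)) :
    L.index = (L.comap (AddMonoidHom.inr M N)).index * (L.map (AddMonoidHom.fst M N)).index := by
  have hk : (AddMonoidHom.fst M N).ker = (AddMonoidHom.inr M N).range := by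
    ext ⟨x, y⟩
    simp [AddSubgroup.mem_prod, eq_comm]
  -- Both indices are measured through `L ⊔ ker`: the image has the index of `L ⊔ ker`, and the
  -- index of `L` in `L ⊔ ker` equals that of `L ∩ ker` in `ker`.
  rw [AddSubgroup.index_map, AddSubgroup.index_comap, ← hk,
    AddMonoidHom.range_eq_top.2 Prod.fst_surjective, AddSubgroup.index_top, mul_one,
    ← AddSubgroup.relIndex_mul_index (le_sup_left : L ≤ L ⊔ (AddMonoidHom.fst M N).ker),
    sup_comm, AddSubgroup.relIndex_sup_right]

/-- The subgroup of `ℤ³` spanned by the rows of an upper triangular matrix. -/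
def hermiteLattice (a b c d f g : ℤ) : AddSubgroup (ℤ × ℤ × ℤ) where
  carrier := {r | ∃ i j k : ℤ, r = (i * a, i * b + j * d, i * c + j * f + k * g)}
  zero_mem' := ⟨0, 0, 0, by simp; rfl⟩
  add_mem' := by
    rintro _ _ ⟨i, j, k, rfl⟩ ⟨i', j', k', rfl⟩
    exact ⟨i + i', j + j', k + k', by ext <;> simp <;> ring⟩
  neg_mem' := by
    rintro _ ⟨i, j, k, rfl⟩
    exact ⟨-i, -j, -k, by ext <;> simp <;> ring⟩

theorem mem_hermiteLattice {a b c d f g x y z : ℤ} :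
    (x, y, z) ∈ hermiteLattice a b c d f g ↔
      ∃ i j k : ℤ, x = i * a ∧ y = i * b + j * d ∧ z = i * c + j * f + k * g := by
  change (∃ i j k : ℤ, (x, y, z) = (i * a, i * b + j * d, i * c + j * f + k * g)) ↔ _
  simp only [Prod.mk.injEq]

theorem zero_mk_mem_hermiteLattice {a b c d f g y z : ℤ} (ha : a ≠ 0) :
    (0, y, z) ∈ hermiteLattice a b c d f g ↔
      ∃ j k : ℤ, y = j * d ∧ z = j * f + k * g := by
  rw [mem_hermiteLattice]
  constructor
  · rintro ⟨i, j, k, hi, hy, hz⟩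
    obtain rfl : i = 0 := by simpa [ha] using hi.symm
    exact ⟨j, k, by simpa using hy, by simpa using hz⟩
  · rintro ⟨j, k, hy, hz⟩
    exact ⟨0, j, k, by simp, by simpa using hy, by simpa using hz⟩

theorem zero_zero_mk_mem_hermiteLattice {a b c d f g z : ℤ} (ha : a ≠ 0) (hd : d ≠ 0) :
    (0, 0, z) ∈ hermiteLattice a b c d f g ↔ g ∣ z := by
  rw [zero_mk_mem_hermiteLattice ha]
  constructor
  · rintro ⟨j, k, hy, hz⟩
    obtain rfl : j = 0 := by simpa [hd] using hy.symm
    exact ⟨k, by rw [hz]; ring⟩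
  · rintro ⟨k, rfl⟩
    exact ⟨0, k, by simp, by ring⟩

theorem row_one_mem_hermiteLattice (a b c d f g : ℤ) : (a, b, c) ∈ hermiteLattice a b c d f g :=
  mem_hermiteLattice.2 ⟨1, 0, 0, by ring, by ring, by ring⟩

theorem row_two_mem_hermiteLattice (a b c d f g : ℤ) : (0, d, f) ∈ hermiteLattice a b c d f g :=
  mem_hermiteLattice.2 ⟨0, 1, 0, by ring, by ring, by ring⟩

theorem row_three_mem_hermiteLattice (a b c d f g : ℤ) : (0, 0, g) ∈ hermiteLattice a b c d f g :=
  mem_hermiteLattice.2 ⟨0, 0, 1, by ring, by ring, by ring⟩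

theorem index_hermiteLattice {a d : ℕ} (b c f : ℤ) (g : ℕ) (ha : a ≠ 0) (hd : d ≠ 0) :
    (hermiteLattice a b c d f g).index = a * d * g := by
  have ha' : (a : ℤ) ≠ 0 := by exact_mod_cast ha
  have hd' : (d : ℤ) ≠ 0 := by exact_mod_cast hd
  have h1 : (hermiteLattice a b c d f g).map (AddMonoidHom.fst ℤ (ℤ × ℤ)) =
      AddSubgroup.zmultiples (a : ℤ) := by
    ext x
    rw [AddSubgroup.mem_map, Int.mem_zmultiples_iff]
    constructor
    · rintro ⟨⟨_, y, z⟩, hr, rfl⟩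
      obtain ⟨i, j, k, rfl, -, -⟩ := mem_hermiteLattice.1 hr
      exact dvd_mul_left _ _
    · rintro ⟨i, rfl⟩
      exact ⟨(a * i, i * b, i * c),
        mem_hermiteLattice.2 ⟨i, 0, 0, by ring, by ring, by ring⟩, rfl⟩
  have h2 : ((hermiteLattice a b c d f g).comap (AddMonoidHom.inr ℤ (ℤ × ℤ))).map
      (AddMonoidHom.fst ℤ ℤ) = AddSubgroup.zmultiples (d : ℤ) := by
    ext x
    rw [AddSubgroup.mem_map, Int.mem_zmultiples_iff]
    constructor
    · rintro ⟨⟨_, z⟩, hr, rfl⟩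
      obtain ⟨j, k, rfl, -⟩ := (zero_mk_mem_hermiteLattice ha').1 hr
      exact dvd_mul_left _ _
    · rintro ⟨j, rfl⟩
      exact ⟨(d * j, j * f),
        (zero_mk_mem_hermiteLattice ha').2 ⟨j, 0, by ring, by ring⟩, rfl⟩
  have h3 : ((hermiteLattice a b c d f g).comap (AddMonoidHom.inr ℤ (ℤ × ℤ))).comap
      (AddMonoidHom.inr ℤ ℤ) = AddSubgroup.zmultiples (g : ℤ) := by
    ext z
    rw [Int.mem_zmultiples_iff]
    exact zero_zero_mk_mem_hermiteLattice ha' hd'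
  rw [AddSubgroup.index_eq_index_comap_inr_mul_index_map_fst, h1,
    AddSubgroup.index_eq_index_comap_inr_mul_index_map_fst, h2, h3, Int.index_zmultiples,
    Int.index_zmultiples, Int.index_zmultiples, Int.natAbs_natCast, Int.natAbs_natCast,
    Int.natAbs_natCast]
  ring

theorem Int.exists_natCast_zmultiples (H : AddSubgroup ℤ) :
    ∃ a : ℕ, H = AddSubgroup.zmultiples (a : ℤ) := by
  obtain ⟨a, rfl⟩ := Int.subgroup_cyclic H
  exact ⟨a.natAbs, by rw [← AddSubgroup.zmultiples_eq_closure, Int.zmultiples_natAbs]⟩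

theorem Int.exists_mul_add_natCast_lt (b : ℤ) {d : ℕ} (hd : d ≠ 0) :
    ∃ (q : ℤ) (r : ℕ), r < d ∧ b = q * d + r := by
  have hd' : (0 : ℤ) < d := by positivity
  have h0 := Int.emod_nonneg b hd'.ne'
  have h1 := Int.emod_lt_of_pos b hd'
  refine ⟨b / d, (b % d).toNat, by omega, ?_⟩
  rw [Int.toNat_of_nonneg h0, mul_comm]
  exact (Int.mul_ediv_add_emod b d).symm

/-- The diagonal entries generate the leading coordinates of `L` and of its intersections with `0 ×
ℤ × ℤ` and `0 × 0 × ℤ`; finite index makes them nonzero. Lifts of these generators are then reduced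
modulo the rows below. -/
theorem exists_eq_hermiteLattice (L : AddSubgroup (ℤ × ℤ × ℤ)) (hL : L.index ≠ 0) :
    ∃ a d g b c f : ℕ, a ≠ 0 ∧ d ≠ 0 ∧ g ≠ 0 ∧ b < d ∧ c < g ∧ f < g ∧
      L = hermiteLattice a b c d f g := by
  rw [AddSubgroup.index_eq_index_comap_inr_mul_index_map_fst,
    AddSubgroup.index_eq_index_comap_inr_mul_index_map_fst] at hL
  obtain ⟨a, ha⟩ := Int.exists_natCast_zmultiples (L.map (AddMonoidHom.fst ℤ (ℤ × ℤ)))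
  obtain ⟨d, hd⟩ := Int.exists_natCast_zmultiples
    ((L.comap (AddMonoidHom.inr ℤ (ℤ × ℤ))).map (AddMonoidHom.fst ℤ ℤ))
  obtain ⟨g, hg⟩ := Int.exists_natCast_zmultiples
    ((L.comap (AddMonoidHom.inr ℤ (ℤ × ℤ))).comap (AddMonoidHom.inr ℤ ℤ))
  rw [ha, hd, hg] at hL
  simp only [Int.index_zmultiples, Int.natAbs_natCast, ne_eq, mul_eq_zero, not_or] at hL
  obtain ⟨⟨hg0, hd0⟩, ha0⟩ := hL
  have mem_g (z : ℤ) : (0, 0, z) ∈ L ↔ (g : ℤ) ∣ z := by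
    rw [← Int.mem_zmultiples_iff, ← hg]
    rfl
  have mem_d (y z : ℤ) (h : (0, y, z) ∈ L) : (d : ℤ) ∣ y := by
    rw [← Int.mem_zmultiples_iff, ← hd]
    exact ⟨(y, z), h, rfl⟩
  have mem_a (x y z : ℤ) (h : (x, y, z) ∈ L) : (a : ℤ) ∣ x := by
    rw [← Int.mem_zmultiples_iff, ← ha]
    exact ⟨(x, y, z), h, rfl⟩
  obtain ⟨⟨d', f₀⟩, hf₀, h⟩ : (d : ℤ) ∈ (L.comap (AddMonoidHom.inr ℤ (ℤ × ℤ))).map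
      (AddMonoidHom.fst ℤ ℤ) := by rw [hd]; exact AddSubgroup.mem_zmultiples _
  obtain rfl : d' = d := h
  replace hf₀ : ((0 : ℤ), (d : ℤ), f₀) ∈ L := hf₀
  obtain ⟨⟨a', b₀, c₀⟩, hb₀, h⟩ : (a : ℤ) ∈ L.map (AddMonoidHom.fst ℤ (ℤ × ℤ)) := by
    rw [ha]; exact AddSubgroup.mem_zmultiples _
  obtain rfl : a' = a := h
  replace hb₀ : ((a : ℤ), b₀, c₀) ∈ L := hb₀
  obtain ⟨q₁, f, hfg, rfl⟩ := Int.exists_mul_add_natCast_lt f₀ hg0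
  obtain ⟨q₂, b, hbd, rfl⟩ := Int.exists_mul_add_natCast_lt b₀ hd0
  have row2 : ((0 : ℤ), (d : ℤ), (f : ℤ)) ∈ L := by
    have := L.sub_mem hf₀ ((mem_g (q₁ * g)).2 (dvd_mul_left _ _))
    simpa using this
  -- Reducing `b₀` by `q₂` copies of the second row has already changed the last entry to `c₀ - q₂ *
  -- f`.
  obtain ⟨q₃, c, hcg, hc⟩ := Int.exists_mul_add_natCast_lt (c₀ - q₂ * f) hg0
  have row1 : ((a : ℤ), (b : ℤ), (c : ℤ)) ∈ L := by
    have := L.sub_mem (L.sub_mem hb₀ (L.zsmul_mem row2 q₂)) ((mem_g (q₃ * g)).2 (dvd_mul_left _ _))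
    convert this using 1
    ext
    · simp
    · simp
    · simp
      linarith
  refine ⟨a, d, g, b, c, f, ha0, hd0, hg0, hbd, hcg, hfg, ?_⟩
  ext ⟨x, y, z⟩
  rw [mem_hermiteLattice]
  constructor
  · intro h
    obtain ⟨i, rfl⟩ := mem_a _ _ _ h
    have h' : ((0 : ℤ), y - i * b, z - i * c) ∈ L := by
      have := L.sub_mem h (L.zsmul_mem row1 i)
      convert this using 1
      ext <;> simp
      ring
    obtain ⟨j, hj⟩ := mem_d _ _ h'
    have h'' : ((0 : ℤ), (0 : ℤ), z - i * c - j * f) ∈ L := by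
      have := L.sub_mem h' (L.zsmul_mem row2 j)
      convert this using 1
      ext <;> simp
      linarith
    obtain ⟨k, hk⟩ := (mem_g _).1 h''
    exact ⟨i, j, k, by ring, by linarith, by linarith⟩
  · rintro ⟨i, j, k, rfl, rfl, rfl⟩
    have := L.add_mem (L.add_mem (L.zsmul_mem row1 i) (L.zsmul_mem row2 j))
      ((mem_g (k * g)).2 (dvd_mul_left _ _))
    convert this using 1
    ext <;> simp

/-- The diagonals divide each other. Writing the rows of one matrix in terms of the other, the
diagonal coefficients are `1`, and the reduced entries agree because they are congruent remainders.
-/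
theorem hermiteLattice_injective {a d g b c f a' d' g' b' c' f' : ℕ} (ha : a ≠ 0) (hd : d ≠ 0)
    (hb : b < d) (hc : c < g) (hf : f < g) (ha' : a' ≠ 0) (hd' : d' ≠ 0)
    (hb' : b' < d') (hc' : c' < g') (hf' : f' < g')
    (h : hermiteLattice a b c d f g = hermiteLattice a' b' c' d' f' g') :
    a = a' ∧ d = d' ∧ g = g' ∧ b = b' ∧ c = c' ∧ f = f' := by
  have za : (a : ℤ) ≠ 0 := by exact_mod_cast ha
  have za' : (a' : ℤ) ≠ 0 := by exact_mod_cast ha'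
  have zd : (d : ℤ) ≠ 0 := by exact_mod_cast hd
  have zd' : (d' : ℤ) ≠ 0 := by exact_mod_cast hd'
  have small {m x y : ℕ} (hx : x < m) (hy : y < m) (k : ℤ) (hk : (x : ℤ) = y + k * m) : x = y := by
    have : (x : ℤ) ≡ y [ZMOD m] := by
      rw [Int.modEq_iff_dvd]
      exact ⟨-k, by linarith⟩
    exact Nat.ModEq.eq_of_lt_of_lt ((Int.natCast_modEq_iff).1 this) hx hy
  have hg : g = g' := by
    apply Nat.dvd_antisymm <;> rw [← Int.natCast_dvd_natCast]
    · rw [← zero_zero_mk_mem_hermiteLattice (b := b) (c := c) (f := f) za zd, h]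
      exact row_three_mem_hermiteLattice ..
    · rw [← zero_zero_mk_mem_hermiteLattice (b := b') (c := c') (f := f') za' zd', ← h]
      exact row_three_mem_hermiteLattice ..
  have h2 := row_two_mem_hermiteLattice a b c d f g
  rw [h, zero_mk_mem_hermiteLattice za'] at h2
  obtain ⟨j, k, hj, hk⟩ := h2
  have h2' := row_two_mem_hermiteLattice a' b' c' d' f' g'
  rw [← h, zero_mk_mem_hermiteLattice za] at h2'
  have hdd : d = d' := by
    obtain ⟨j', k', hj', -⟩ := h2'
    apply Nat.dvd_antisymm <;> rw [← Int.natCast_dvd_natCast]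
    · exact ⟨j', by rw [hj']; ring⟩
    · exact ⟨j, by rw [hj]; ring⟩
  have h1 := row_one_mem_hermiteLattice a b c d f g
  rw [h, mem_hermiteLattice] at h1
  obtain ⟨i₁, j₁, k₁, hi₁, hj₁, hk₁⟩ := h1
  have h1' := row_one_mem_hermiteLattice a' b' c' d' f' g'
  rw [← h, mem_hermiteLattice] at h1'
  have haa : a = a' := by
    obtain ⟨i', _, _, hi', -, -⟩ := h1'
    apply Nat.dvd_antisymm <;> rw [← Int.natCast_dvd_natCast]
    · exact ⟨i', by rw [hi']; ring⟩
    · exact ⟨i₁, by rw [hi₁]; ring⟩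
  subst hg hdd haa
  obtain rfl : j = 1 := by
    have : (j - 1) * (d : ℤ) = 0 := by linarith
    have := (mul_eq_zero.1 this).resolve_right zd
    linarith
  obtain rfl : i₁ = 1 := by
    have : (i₁ - 1) * (a : ℤ) = 0 := by linarith
    have := (mul_eq_zero.1 this).resolve_right za
    linarith
  have hff : f = f' := small hf hf' k (by linarith)
  have hbb : b = b' := small hb hb' j₁ (by linarith)
  subst hff hbb
  obtain rfl : j₁ = 0 := by
    have : j₁ * (d : ℤ) = 0 := by linarith
    exact (mul_eq_zero.1 this).resolve_right zd
  exact ⟨rfl, rfl, rfl, rfl, small hc hc' k₁ (by linarith), rfl⟩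

/-! ### Stable subgroups and their number. -/

/-- Stability under multiplication by `y` for the coordinates with respect to the basis
`1, y, y * (y - 3)` of `ℤ[y] / (y * (y - 3) * (y - 5))`. -/
def IsShiftStable (L : AddSubgroup (ℤ × ℤ × ℤ)) : Prop :=
  ∀ x y z : ℤ, (x, y, z) ∈ L → (0, x + 3 * y, y + 5 * z) ∈ L

/-- It suffices to test the rows. The second maps to `(0, 3 * d, d + 5 * f)`, which is three times
itself plus `(0, 0, d + 2 * f)`; the first maps to `(0, a + 3 * b, b + 5 * c)`, from which `(a + 3 *
b) / d` copies of the second are removed; the third is merely scaled by `5`. -/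
theorem isShiftStable_hermiteLattice_iff {a b c d f g : ℤ} (ha : a ≠ 0) (hd : d ≠ 0) :
    IsShiftStable (hermiteLattice a b c d f g) ↔
      g ∣ d + 2 * f ∧ d ∣ a + 3 * b ∧ g ∣ b - (a + 3 * b) / d * f + 5 * c := by
  constructor
  · intro h
    have h1 := h _ _ _ (row_one_mem_hermiteLattice a b c d f g)
    have h2 := h _ _ _ (row_two_mem_hermiteLattice a b c d f g)
    rw [zero_mk_mem_hermiteLattice ha] at h1 h2
    obtain ⟨q, k, hq, hk⟩ := h1
    obtain ⟨j, l, hj, hl⟩ := h2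
    obtain rfl : j = 3 := by
      have : (j - 3) * d = 0 := by linarith
      have := (mul_eq_zero.1 this).resolve_right hd
      linarith
    refine ⟨⟨l, by linarith⟩, ⟨q, by linarith⟩, ⟨k, ?_⟩⟩
    rw [hq, Int.mul_ediv_cancel _ hd]
    linarith
  · rintro ⟨⟨l, hl⟩, ⟨q, hq⟩, ⟨k, hk⟩⟩ x y z h
    rw [hq, Int.mul_ediv_cancel_left _ hd] at hk
    obtain ⟨i, j, m, rfl, rfl, rfl⟩ := mem_hermiteLattice.1 h
    rw [zero_mk_mem_hermiteLattice ha]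
    exact ⟨i * q + 3 * j, i * k + j * l + 5 * m, by linear_combination i * hq,
      by linear_combination i * hk + j * hl⟩

/-- The entries above the diagonal of the Hermite normal forms with diagonal `a, d, g` that span
a subgroup stable under multiplication by `y`. -/
def stableHermiteEntries (a d g : ℕ) : Finset (ℕ × ℕ × ℕ) :=
  (Finset.range g ×ˢ Finset.range d ×ˢ Finset.range g).filter fun t =>
    (g : ℤ) ∣ d + 2 * t.1 ∧ (d : ℤ) ∣ a + 3 * t.2.1 ∧
      (g : ℤ) ∣ t.2.1 - (a + 3 * t.2.1) / d * t.1 + 5 * t.2.2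

/-- Choose `f` and `b` independently, then `c`. The number of `c` seems to depend on `f` and `b`,
but the first two congruences reduce it to a condition on `a` alone. -/
theorem card_stableHermiteEntries {a d g : ℕ} (hd : 0 < d) (hg : 0 < g) :
    ((stableHermiteEntries a d g).card : ℤ) =
      congruenceWeight 2 d g * (congruenceWeight 3 a d * congruenceWeight 5 a g) := by
  have key (f b : ℕ) : (if (g : ℤ) ∣ d + 2 * f ∧ (d : ℤ) ∣ a + 3 * b then
      ∑ c ∈ Finset.range g,
        (if (g : ℤ) ∣ (b - (a + 3 * b) / d * f : ℤ) + 5 * c then (1 : ℤ) else 0) else 0) =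
      (if (g : ℤ) ∣ d + 2 * f then 1 else 0) * ((if (d : ℤ) ∣ a + 3 * b then 1 else 0) *
        congruenceWeight 5 a g) := by
    have h5 := sum_range_ite_dvd_add_prime_mul (p := 5) (by norm_num) hg
      ((b - (a + 3 * b) / d * f : ℤ))
    push_cast at h5
    rw [h5]
    by_cases h1 : (g : ℤ) ∣ d + 2 * f <;> by_cases h2 : (d : ℤ) ∣ a + 3 * b <;> simp only [h1, h2,
      and_self, if_true, if_false, and_false, false_and, one_mul, zero_mul, mul_zero]
    obtain ⟨q, hq⟩ := h2
    rw [hq, Int.mul_ediv_cancel_left _ (by exact_mod_cast hd.ne')]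
    simp only [congruenceWeight]
    by_cases h3 : ((5 : ℕ) : ℤ) ∣ g
    · rw [if_pos h3, if_pos h3]
      congr 1
      rw [eq_iff_iff]
      obtain ⟨l, hl⟩ := h3.trans h1
      -- Modulo `5`, `2 * f ≡ -d` and `q * d = a + 3 * b`, so `2 * (b - q * f) ≡ 2 * b + q * d ≡ a`;
      -- and `2` is invertible.
      have h4 : 2 * ((b : ℤ) - q * f) = a + 5 * (b - l * q) := by
        push_cast at hl
        linear_combination (-q) * hl - hq
      push_cast
      omega
    · rw [if_neg h3, if_neg h3]
  rw [stableHermiteEntries, Finset.card_filter, Nat.cast_sum, Finset.sum_product]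
  simp_rw [Finset.sum_product]
  have h2 := sum_range_ite_dvd_add_prime_mul (p := 2) (by norm_num) hg d
  have h3 := sum_range_ite_dvd_add_prime_mul (p := 3) (by norm_num) hd a
  push_cast at h2 h3 ⊢
  rw [← h2, ← h3, Finset.sum_mul]
  refine Finset.sum_congr rfl fun f _ => ?_
  rw [Finset.sum_mul, Finset.mul_sum]
  refine Finset.sum_congr rfl fun b _ => ?_
  rw [← key]
  simp_rw [← and_assoc, ite_and (_ ∧ _)]
  split_ifs <;> simp

/-- The Hermite normal forms of the stable subgroups of index `n`. -/
def stableHermiteForms (n : ℕ) : Finset (Σ _ : Fin 3 → ℕ, ℕ × ℕ × ℕ) :=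
  (Nat.finMulAntidiag 3 n).sigma fun x => stableHermiteEntries (x 0) (x 1) (x 2)

theorem card_stableHermiteForms (n : ℕ) :
    ((stableHermiteForms n).card : ℤ) =
      ((∏ p ∈ ({2, 3, 5} : Finset ℕ), localFactor p) *
        (ArithmeticFunction.zeta : ArithmeticFunction ℤ) ^ 3) n := by
  rw [← factorizationSum_congruenceWeight_eq, factorizationSum_apply, stableHermiteForms,
    Finset.card_sigma, Nat.cast_sum]
  refine Finset.sum_congr rfl fun x hx => ?_
  have h0 := Nat.ne_zero_of_mem_finMulAntidiag hx
  exact card_stableHermiteEntries (Nat.pos_of_ne_zero (h0 1)) (Nat.pos_of_ne_zero (h0 2))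

theorem bijOn_stableHermiteForms {n : ℕ} (hn : n ≠ 0) :
    Set.BijOn (fun t : Σ _ : Fin 3 → ℕ, ℕ × ℕ × ℕ =>
        hermiteLattice (t.1 0) t.2.2.1 t.2.2.2 (t.1 1) t.2.1 (t.1 2))
      (stableHermiteForms n) {L | IsShiftStable L ∧ L.index = n} := by
  refine ⟨?_, ?_, ?_⟩
  · rintro ⟨x, f, b, c⟩ ht
    simp only [stableHermiteForms, stableHermiteEntries, Finset.coe_sigma, Set.mem_sigma_iff,
      Finset.mem_coe, Finset.mem_filter, Finset.mem_product, Finset.mem_range] at ht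
    obtain ⟨hx, -, hs⟩ := ht
    have h0 := Nat.ne_zero_of_mem_finMulAntidiag hx
    refine ⟨?_, ?_⟩
    · exact (isShiftStable_hermiteLattice_iff (by exact_mod_cast h0 0)
        (by exact_mod_cast h0 1)).2 hs
    · rw [index_hermiteLattice _ _ _ _ (h0 0) (h0 1)]
      exact Nat.finMulAntidiag_three x hx
  · rintro ⟨x, f, b, c⟩ ht ⟨x', f', b', c'⟩ ht' h
    simp only [stableHermiteForms, stableHermiteEntries, Finset.coe_sigma, Set.mem_sigma_iff,
      Finset.mem_coe, Finset.mem_filter, Finset.mem_product, Finset.mem_range] at ht ht'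
    obtain ⟨hx, ⟨hf, hb, hc⟩, -⟩ := ht
    obtain ⟨hx', ⟨hf', hb', hc'⟩, -⟩ := ht'
    have h0 := Nat.ne_zero_of_mem_finMulAntidiag hx
    have h0' := Nat.ne_zero_of_mem_finMulAntidiag hx'
    obtain ⟨e0, e1, e2, rfl, rfl, rfl⟩ := hermiteLattice_injective (h0 0) (h0 1) hb hc hf
      (h0' 0) (h0' 1) hb' hc' hf' h
    obtain rfl : x = x' := by
      ext j
      fin_cases j
      exacts [e0, e1, e2]
    rfl
  · rintro L ⟨hs, hL⟩
    obtain ⟨a, d, g, b, c, f, ha, hd, hg, hb, hc, hf, rfl⟩ :=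
      exists_eq_hermiteLattice L (hL ▸ hn)
    rw [index_hermiteLattice _ _ _ _ ha hd] at hL
    rw [isShiftStable_hermiteLattice_iff (by exact_mod_cast ha) (by exact_mod_cast hd)] at hs
    refine ⟨⟨![a, d, g], f, b, c⟩, ?_, rfl⟩
    simp only [stableHermiteForms, stableHermiteEntries, Finset.coe_sigma, Set.mem_sigma_iff,
      Finset.mem_coe, Finset.mem_filter, Finset.mem_product, Finset.mem_range]
    refine ⟨?_, ⟨hf, hb, hc⟩, hs⟩
    rw [Nat.mem_finMulAntidiag]
    exact ⟨by simpa [Fin.prod_univ_three] using hL, hn⟩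

/-! ### Ideals as stable subgroups. -/

/-- For a ring with basis `1, y, y * (y - 3)`, where `y * (y - 3) * (y - 5) = 0`, over which
additive subgroups stable under `y` are ideals, the ideals of index `n` are in bijection with the
stable subgroups of `ℤ³` of index `n`. -/
theorem bijOn_comap_idealsOfIndex {R : Type*} [CommRing R] (y : R) (e : (ℤ × ℤ × ℤ) ≃+ R)
    (hgen : ∀ L : AddSubgroup R, (∀ r ∈ L, y * r ∈ L) → ∀ s, ∀ r ∈ L, s * r ∈ L)
    (he : ∀ r₀ r₁ r₂ : ℤ, y * e (r₀, r₁, r₂) = e (0, r₀ + 3 * r₁, r₁ + 5 * r₂)) (n : ℕ) :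
    Set.BijOn (fun I : Ideal R => I.toAddSubgroup.comap e.toAddMonoidHom)
      (idealsOfIndex R n) {L | IsShiftStable L ∧ L.index = n} := by
  have hidx (L : AddSubgroup R) : (L.comap e.toAddMonoidHom).index = L.index :=
    AddSubgroup.index_comap_of_surjective L e.surjective
  refine ⟨?_, ?_, ?_⟩
  · intro I hI
    refine ⟨fun r₀ r₁ r₂ h => ?_, (hidx _).trans hI⟩
    change e _ ∈ I at h
    change e _ ∈ I
    rw [← he]
    exact I.mul_mem_left _ h
  · intro I _ J _ h
    have h' := AddSubgroup.comap_injective (f := e.toAddMonoidHom) e.surjective h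
    ext r
    change r ∈ I.toAddSubgroup ↔ r ∈ J.toAddSubgroup
    rw [h']
  · rintro L ⟨hs, hL⟩
    have hc : (L.comap e.symm.toAddMonoidHom).comap e.toAddMonoidHom = L := by
      ext r
      change e.symm (e r) ∈ L ↔ r ∈ L
      rw [e.symm_apply_apply]
    have hstable : ∀ r ∈ L.comap e.symm.toAddMonoidHom, y * r ∈ L.comap e.symm.toAddMonoidHom := by
      intro r hr
      obtain ⟨⟨r₀, r₁, r₂⟩, rfl⟩ := e.surjective r
      change e.symm (e _) ∈ L at hr
      change e.symm (y * e _) ∈ L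
      rw [e.symm_apply_apply] at hr
      rw [he, e.symm_apply_apply]
      exact hs _ _ _ hr
    let I : Ideal R :=
      { L.comap e.symm.toAddMonoidHom with
        smul_mem' := fun s r hr => hgen _ hstable s r hr }
    have hI : I.toAddSubgroup = L.comap e.symm.toAddMonoidHom := rfl
    refine ⟨I, ?_, ?_⟩
    · change I.toAddSubgroup.index = n
      rw [← hidx, hI, hc, hL]
    · change I.toAddSubgroup.comap e.toAddMonoidHom = L
      rw [hI, hc]

theorem finite_idealsOfIndex {R : Type*} [CommRing R] (y : R) (e : (ℤ × ℤ × ℤ) ≃+ R)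
    (hgen : ∀ L : AddSubgroup R, (∀ r ∈ L, y * r ∈ L) → ∀ s, ∀ r ∈ L, s * r ∈ L)
    (he : ∀ r₀ r₁ r₂ : ℤ, y * e (r₀, r₁, r₂) = e (0, r₀ + 3 * r₁, r₁ + 5 * r₂)) {n : ℕ}
    (hn : n ≠ 0) : (idealsOfIndex R n).Finite := by
  rw [(bijOn_comap_idealsOfIndex y e hgen he n).finite_iff_finite,
    ← (bijOn_stableHermiteForms hn).finite_iff_finite]
  exact Finset.finite_toSet _

theorem idealZeta_eq {R : Type*} [CommRing R] (y : R) (e : (ℤ × ℤ × ℤ) ≃+ R)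
    (hgen : ∀ L : AddSubgroup R, (∀ r ∈ L, y * r ∈ L) → ∀ s, ∀ r ∈ L, s * r ∈ L)
    (he : ∀ r₀ r₁ r₂ : ℤ, y * e (r₀, r₁, r₂) = e (0, r₀ + 3 * r₁, r₁ + 5 * r₂)) :
    idealZeta R = (∏ p ∈ ({2, 3, 5} : Finset ℕ), localFactor p) *
        (ArithmeticFunction.zeta : ArithmeticFunction ℤ) ^ 3 := by
  ext n
  rcases eq_or_ne n 0 with rfl | hn
  · simp
  have h1 := bijOn_comap_idealsOfIndex y e hgen he n
  have h2 := bijOn_stableHermiteForms hn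
  rw [← card_stableHermiteForms]
  change (if n = 0 then 0 else ((idealsOfIndex R n).ncard : ℤ)) = _
  rw [if_neg hn, ← h1.injOn.ncard_image, h1.image_eq, ← h2.image_eq,
    h2.injOn.ncard_image, Set.ncard_coe_finset]

/-! ### The Petersen graph and its spectrum. -/

/-- Strong regularity with parameters `(10, 3, 0, 1)`, the only computation with the graph itself;
it is checked over all pairs of vertices. -/
theorem card_filter_petersenGraph (s t : {s : Finset (Fin 5) // s.card = 2}) :
    (Finset.univ.filter fun u : {s : Finset (Fin 5) // s.card = 2} =>
      Disjoint s.1 u.1 ∧ Disjoint u.1 t.1).card =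
      if s = t then 3 else if Disjoint s.1 t.1 then 0 else 1 := by
  revert s t
  decide +kernel

theorem exists_ne_not_adj {V : Type*} {G : SimpleGraph V}
    (hG : Nonempty (G ≃g petersenGraph)) :
    ∃ v w : V, v ≠ w ∧ ¬ G.Adj v w := by
  obtain ⟨φ⟩ := hG
  refine ⟨φ.symm ⟨{0, 1}, rfl⟩, φ.symm ⟨{0, 2}, rfl⟩, ?_, ?_⟩
  · rw [ne_eq, φ.symm.injective.eq_iff]
    decide
  · rw [φ.symm.map_adj_iff]
    change ¬ Disjoint _ _
    decide

theorem exists_adj {V : Type*} {G : SimpleGraph V}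
    (hG : Nonempty (G ≃g petersenGraph)) : ∃ v w : V, G.Adj v w := by
  obtain ⟨φ⟩ := hG
  refine ⟨φ.symm ⟨{0, 1}, rfl⟩, φ.symm ⟨{2, 3}, rfl⟩, ?_⟩
  rw [φ.symm.map_adj_iff]
  change Disjoint _ _
  decide

section PetersenGraph

variable {V : Type*} [Fintype V] [DecidableEq V] {G : SimpleGraph V} [DecidableRel G.Adj]

theorem card_filter_adj_adj (hG : Nonempty (G ≃g petersenGraph)) (v w : V) :
    (Finset.univ.filter fun u => G.Adj v u ∧ G.Adj u w).card =
      if v = w then 3 else if G.Adj v w then 0 else 1 := by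
  obtain ⟨φ⟩ := hG
  have hadj (v w : V) : G.Adj v w ↔ Disjoint (φ v).1 (φ w).1 := φ.map_adj_iff.symm
  have h := card_filter_petersenGraph (φ v) (φ w)
  simp only [← hadj, φ.injective.eq_iff] at h
  rw [← h]
  refine Finset.card_equiv φ.toEquiv fun u => ?_
  simp [hadj]

variable (G) in
/-- The all-ones matrix, as a polynomial in the adjacency matrix of the Petersen graph. -/
def onesPolynomial (α : Type*) [CommRing α] : Matrix V V α :=
  (G.adjMatrix α + 2) * (G.adjMatrix α - 1)

variable {α : Type*} [CommRing α]

/-- With `J` the all-ones matrix, strong regularity reads `B² = 3 + (J - 1 - B)`, that is, `B² + B -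
2 = J`. -/
theorem onesPolynomial_apply (hG : Nonempty (G ≃g petersenGraph)) (v w : V) :
    onesPolynomial G α v w = 1 := by
  have h1 : onesPolynomial G α = G.adjMatrix α * G.adjMatrix α + G.adjMatrix α - 2 * 1 := by
    rw [onesPolynomial, ← one_add_one_eq_two]
    noncomm_ring
  have h2 : (G.adjMatrix α * G.adjMatrix α) v w =
      ((Finset.univ.filter fun u => G.Adj v u ∧ G.Adj u w).card : α) := by
    rw [Matrix.mul_apply, Finset.card_filter, Nat.cast_sum]
    refine Finset.sum_congr rfl fun u _ => ?_
    simp only [SimpleGraph.adjMatrix_apply, ite_and]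
    split_ifs <;> simp
  rw [h1, two_mul, Matrix.sub_apply, Matrix.add_apply, Matrix.add_apply, h2,
    card_filter_adj_adj hG, Matrix.one_apply, SimpleGraph.adjMatrix_apply]
  by_cases h : v = w
  · subst h
    simp
    norm_num
  · by_cases h' : G.Adj v w <;> simp [h, h']

theorem adjMatrix_mul_onesPolynomial (hG : Nonempty (G ≃g petersenGraph)) :
    G.adjMatrix α * onesPolynomial G α = 3 * onesPolynomial G α := by
  ext v w
  have h3 : (3 : Matrix V V α) * onesPolynomial G α = (3 : ℕ) • onesPolynomial G α := by
    rw [nsmul_eq_mul]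
    rfl
  have hc := card_filter_adj_adj hG v v
  rw [h3, Matrix.smul_apply, onesPolynomial_apply hG, Matrix.mul_apply]
  simp only [onesPolynomial_apply hG, SimpleGraph.adjMatrix_apply, mul_one]
  rw [← Finset.sum_filter, Finset.sum_const]
  congr 1
  rw [if_pos rfl] at hc
  rw [← hc]
  congr 1
  ext u
  simp [G.adj_comm u v]

theorem spectrum_adjMatrix (hG : Nonempty (G ≃g petersenGraph)) :
    spectrum ℂ (G.adjMatrix ℂ) = {3, 1, -2} := by
  set B := G.adjMatrix ℂ with hB
  have hJ := onesPolynomial_apply (α := ℂ) hG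
  have hBJ : B * ((B + 2) * (B - 1)) = 3 * ((B + 2) * (B - 1)) :=
    adjMatrix_mul_onesPolynomial (α := ℂ) hG
  obtain ⟨v, w, hne, hadj⟩ := exists_ne_not_adj hG
  have hJ0 : ((B + 2) * (B - 1)) v w = 1 := hJ v w
  have hBvw : B v w = 0 := by simp [hB, SimpleGraph.adjMatrix_apply, hadj]
  have hone : (1 : Matrix V V ℂ) v w = 0 := Matrix.one_apply_ne hne
  have three : (3 : Matrix V V ℂ) = 1 + 1 + 1 := by norm_num
  -- An eigenvalue is detected by a nonzero `C` killed by `c - B`. Each `C` below is the product of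
  -- the two other linear factors, written as `J` plus a combination of `B` and `1`; its entry at
  -- the distinct nonadjacent `v, w` is therefore `1`.
  have mem_of_mul (c : ℂ) (C : Matrix V V ℂ) (h : (algebraMap ℂ (Matrix V V ℂ) c - B) * C = 0)
      (hC : C v w = 1) : c ∈ spectrum ℂ B := by
    intro hu
    have : C = 0 := (hu.mul_right_eq_zero).1 h
    simp [this] at hC
  apply Set.Subset.antisymm
  · intro c hc
    have h := spectrum.subset_polynomial_aeval B
      ((Polynomial.X - 3) * ((Polynomial.X + 2) * (Polynomial.X - 1)) : Polynomial ℂ) ⟨c, hc, rfl⟩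
    have h0 : Polynomial.aeval B
        ((Polynomial.X - 3) * ((Polynomial.X + 2) * (Polynomial.X - 1)) : Polynomial ℂ) = 0 := by
      simp only [map_mul, map_add, map_sub, Polynomial.aeval_X, map_ofNat, map_one]
      rw [sub_mul, hBJ, sub_self]
    have : Nonempty V := ⟨v⟩
    rw [h0, spectrum.zero_eq] at h
    simp only [Polynomial.eval_mul, Polynomial.eval_sub, Polynomial.eval_add, Polynomial.eval_X,
      Polynomial.eval_ofNat, Polynomial.eval_one, Set.mem_singleton_iff, mul_eq_zero] at h
    rcases h with h | h | h
    · exact Or.inl (sub_eq_zero.1 h)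
    · exact Or.inr (Or.inr (eq_neg_of_add_eq_zero_left h))
    · exact Or.inr (Or.inl (sub_eq_zero.1 h))
  · have h3 : algebraMap ℂ (Matrix V V ℂ) 3 = 3 := map_ofNat _ 3
    have h1 : algebraMap ℂ (Matrix V V ℂ) 1 = 1 := map_one _
    have h2 : algebraMap ℂ (Matrix V V ℂ) (-2) = -2 := by rw [map_neg, map_ofNat]
    rintro c (rfl | rfl | rfl)
    · refine mem_of_mul _ ((B + 2) * (B - 1)) ?_ hJ0
      rw [h3, sub_mul, hBJ, sub_self]
    · refine mem_of_mul _ ((B + 2) * (B - 1) - 2 • B - 4 • 1) ?_ ?_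
      · rw [h1]
        have : (1 - B) * ((B + 2) * (B - 1) - 2 • B - 4 • 1) =
          3 * ((B + 2) * (B - 1)) - B * ((B + 2) * (B - 1)) := by
          rw [three, ← one_add_one_eq_two]
          noncomm_ring
        rw [this, hBJ, sub_self]
      · simp only [Matrix.sub_apply, Matrix.smul_apply, hJ0, hBvw, hone]
        norm_num
    · refine mem_of_mul _ ((B + 2) * (B - 1) - 5 • B + 5 • 1) ?_ ?_
      · rw [h2]
        have : (-2 - B) * ((B + 2) * (B - 1) - 5 • B + 5 • 1) =
          3 * ((B + 2) * (B - 1)) - B * ((B + 2) * (B - 1)) := by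
          rw [three, ← one_add_one_eq_two]
          noncomm_ring
        rw [this, hBJ, sub_self]
      · simp only [Matrix.add_apply, Matrix.sub_apply, Matrix.smul_apply, hJ0, hBvw, hone]
        norm_num

/-! ### The Newton basis of `ℤ[B]`. -/

theorem add_two_sub_three {R : Type*} [Ring R] (x : R) : x + 2 - 3 = x - 1 := by
  rw [add_sub_assoc, show (2 : R) - 3 = -1 by norm_num, ← sub_eq_add_neg]

variable (G) in
/-- The generator `B + 2` of `ℤ[B]`. -/
def shiftedGenerator : matrixOrder (G.adjMatrix ℤ) :=
  ⟨G.adjMatrix ℤ, Algebra.self_mem_adjoin_singleton ℤ _⟩ + 2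

theorem shiftedGenerator_mul (hG : Nonempty (G ≃g petersenGraph)) :
    shiftedGenerator G * (shiftedGenerator G * (shiftedGenerator G - 3)) =
      5 * (shiftedGenerator G * (shiftedGenerator G - 3)) := by
  apply Subtype.ext
  have h := adjMatrix_mul_onesPolynomial (α := ℤ) hG
  rw [onesPolynomial] at h
  change (G.adjMatrix ℤ + 2) * ((G.adjMatrix ℤ + 2) * (G.adjMatrix ℤ + 2 - 3)) =
    5 * ((G.adjMatrix ℤ + 2) * (G.adjMatrix ℤ + 2 - 3))
  have h1 : G.adjMatrix ℤ + 2 - 3 = G.adjMatrix ℤ - 1 := add_two_sub_three _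
  rw [h1, add_mul, h]
  noncomm_ring

variable (G) in
/-- The linear combinations of `1, y, y * (y - 3)`, where `y = B + 2`. -/
def newtonCombination : (ℤ × ℤ × ℤ) →+ matrixOrder (G.adjMatrix ℤ) where
  toFun r := r.1 + r.2.1 * shiftedGenerator G +
    r.2.2 * (shiftedGenerator G * (shiftedGenerator G - 3))
  map_zero' := by simp
  map_add' r s := by
    simp only [Prod.fst_add, Prod.snd_add]
    push_cast
    ring

theorem newtonCombination_apply (r₀ r₁ r₂ : ℤ) :
    newtonCombination G (r₀, r₁, r₂) = r₀ + r₁ * shiftedGenerator G +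
      r₂ * (shiftedGenerator G * (shiftedGenerator G - 3)) := rfl

theorem shiftedGenerator_mul_newtonCombination (hG : Nonempty (G ≃g petersenGraph))
    (r₀ r₁ r₂ : ℤ) : shiftedGenerator G * newtonCombination G (r₀, r₁, r₂) =
      newtonCombination G (0, r₀ + 3 * r₁, r₁ + 5 * r₂) := by
  rw [newtonCombination_apply, newtonCombination_apply]
  push_cast
  linear_combination (r₂ : matrixOrder (G.adjMatrix ℤ)) * shiftedGenerator_mul hG

/-- Since `y * (y - 3) = J`, the entries at a nonadjacent pair, an adjacent pair and a diagonal
position give `r₂ = 0`, `r₁ + r₂ = 0` and `r₀ + 2 * r₁ + r₂ = 0`. -/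
theorem newtonCombination_injective (hG : Nonempty (G ≃g petersenGraph)) :
    Function.Injective (newtonCombination G) := by
  rw [injective_iff_map_eq_zero]
  rintro ⟨r₀, r₁, r₂⟩ h
  have hv : r₀ • (1 : Matrix V V ℤ) + r₁ • (G.adjMatrix ℤ + 2 • 1) +
      r₂ • onesPolynomial G ℤ = 0 := by
    have h' := congrArg (Subtype.val : matrixOrder (G.adjMatrix ℤ) → Matrix V V ℤ) h
    rw [newtonCombination_apply] at h'
    have h1 : G.adjMatrix ℤ + 2 - 3 = G.adjMatrix ℤ - 1 := add_two_sub_three _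
    change (r₀ : Matrix V V ℤ) + r₁ * (G.adjMatrix ℤ + 2) +
      r₂ * ((G.adjMatrix ℤ + 2) * (G.adjMatrix ℤ + 2 - 3)) = 0 at h'
    rw [h1] at h'
    rw [← h', onesPolynomial]
    simp only [zsmul_eq_mul, nsmul_eq_mul, mul_one]
    rfl
  obtain ⟨v, w, hne, hadj⟩ := exists_ne_not_adj hG
  obtain ⟨v', w', hadj'⟩ := exists_adj hG
  have entry (v w : V) : r₀ * (1 : Matrix V V ℤ) v w +
      r₁ * (G.adjMatrix ℤ v w + 2 * (1 : Matrix V V ℤ) v w) + r₂ = 0 := by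
    have := congrFun (congrFun hv v) w
    simp only [Matrix.add_apply, Matrix.smul_apply, onesPolynomial_apply hG, Matrix.zero_apply]
      at this
    simpa only [smul_eq_mul, nsmul_eq_mul, Nat.cast_ofNat, mul_one] using this
  have e1 := entry v w
  have e2 := entry v' w'
  have e3 := entry v v
  rw [Matrix.one_apply_ne hne, SimpleGraph.adjMatrix_apply, if_neg hadj] at e1
  rw [Matrix.one_apply_ne hadj'.ne, SimpleGraph.adjMatrix_apply, if_pos hadj'] at e2
  rw [Matrix.one_apply_eq, SimpleGraph.adjMatrix_apply, if_neg (G.loopless.irrefl v)] at e3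
  obtain ⟨rfl, rfl, rfl⟩ : r₀ = 0 ∧ r₁ = 0 ∧ r₂ = 0 := by omega
  rfl

/-- The range contains `1` and is stable under `y`, hence under `B = y - 2`, so it contains every
polynomial in `B`. -/
theorem newtonCombination_surjective (hG : Nonempty (G ≃g petersenGraph)) :
    Function.Surjective (newtonCombination G) := by
  have hmul (s : matrixOrder (G.adjMatrix ℤ)) (hs : s ∈ (newtonCombination G).range) :
      shiftedGenerator G * s ∈ (newtonCombination G).range := by
    obtain ⟨⟨r₀, r₁, r₂⟩, rfl⟩ := hs
    exact ⟨_, (shiftedGenerator_mul_newtonCombination hG r₀ r₁ r₂).symm⟩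
  set b : matrixOrder (G.adjMatrix ℤ) :=
    ⟨G.adjMatrix ℤ, Algebra.self_mem_adjoin_singleton ℤ _⟩ with hb
  have hpow (n : ℕ) : b ^ n ∈ (newtonCombination G).range := by
    induction n with
    | zero => exact ⟨(1, 0, 0), by simp [newtonCombination_apply]⟩
    | succ n ih =>
      have : b ^ (n + 1) = shiftedGenerator G * b ^ n - 2 • b ^ n := by
        rw [shiftedGenerator, ← hb, nsmul_eq_mul]
        push_cast
        ring
      rw [this]
      exact sub_mem (hmul _ ih) (nsmul_mem ih 2)
  have hpoly (f : Polynomial ℤ) : Polynomial.aeval b f ∈ (newtonCombination G).range := by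
    rw [Polynomial.aeval_eq_sum_range]
    exact sum_mem fun i _ => zsmul_mem (hpow i) _
  rintro ⟨C, hC⟩
  obtain ⟨f, rfl⟩ := (mem_matrixOrder_iff _ _).1 hC
  obtain ⟨r, hr⟩ := hpoly f
  refine ⟨r, hr.trans (Subtype.ext ?_)⟩
  exact (Polynomial.aeval_algHom_apply (matrixOrder (G.adjMatrix ℤ)).val b f).symm

/-- The coordinates of `ℤ[B]` with respect to `1, y, y * (y - 3)`, where `y = B + 2`. -/
noncomputable def newtonEquiv (hG : Nonempty (G ≃g petersenGraph)) :
    (ℤ × ℤ × ℤ) ≃+ matrixOrder (G.adjMatrix ℤ) :=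
  AddEquiv.ofBijective (newtonCombination G)
    ⟨newtonCombination_injective hG, newtonCombination_surjective hG⟩

theorem mul_mem_of_shiftedGenerator_mul_mem (hG : Nonempty (G ≃g petersenGraph))
    (L : AddSubgroup (matrixOrder (G.adjMatrix ℤ))) (hL : ∀ r ∈ L, shiftedGenerator G * r ∈ L)
    (s r : matrixOrder (G.adjMatrix ℤ)) (hr : r ∈ L) : s * r ∈ L := by
  obtain ⟨⟨r₀, r₁, r₂⟩, rfl⟩ := newtonCombination_surjective hG s
  have h1 := hL r hr
  have h2 := hL _ h1
  have : newtonCombination G (r₀, r₁, r₂) * r = r₀ • r + r₁ • (shiftedGenerator G * r) +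
      r₂ • (shiftedGenerator G * (shiftedGenerator G * r) - 3 • (shiftedGenerator G * r)) := by
    rw [newtonCombination_apply]
    simp only [zsmul_eq_mul, nsmul_eq_mul]
    push_cast
    ring
  rw [this]
  exact add_mem (add_mem (zsmul_mem hr _) (zsmul_mem h1 _))
    (zsmul_mem (sub_mem h2 (nsmul_mem h1 3)) _)

end PetersenGraph

/-! ### Values of the Dirichlet series. -/

theorem LSeriesHasSum_ite_eq {p : ℕ} (hp : p ≠ 0) (s : ℂ) :
    LSeriesHasSum (fun n => if n = p then 1 else 0) s ((p : ℂ) ^ (-s)) := by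
  have h : ∀ n, n ≠ p → LSeries.term (fun n => if n = p then 1 else 0) s n = 0 := by
    intro n hn
    rcases eq_or_ne n 0 with rfl | h0
    · simp
    · simp [LSeries.term_of_ne_zero h0, hn]
  have := hasSum_single p h
  rwa [LSeries.term_of_ne_zero hp, if_pos rfl, one_div, ← Complex.cpow_neg] at this

theorem LSeriesHasSum_intCast_mul {f g : ArithmeticFunction ℤ} {s a b : ℂ}
    (hf : LSeriesHasSum (fun n => (f n : ℂ)) s a) (hg : LSeriesHasSum (fun n => (g n : ℂ)) s b) :
    LSeriesHasSum (fun n => ((f * g) n : ℂ)) s (a * b) := by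
  have := ArithmeticFunction.LSeriesHasSum_mul (f := (f : ArithmeticFunction ℂ))
    (g := (g : ArithmeticFunction ℂ)) hf hg
  rw [← ArithmeticFunction.intCoe_mul] at this
  exact this

theorem LSeriesHasSum_localFactor {p : ℕ} (hp : 1 < p) (s : ℂ) :
    LSeriesHasSum (fun n => (localFactor p n : ℂ)) s
      (1 - (p : ℂ) ^ (-s) + (p : ℂ) ^ (1 - 2 * s)) := by
  have hp0 : (p : ℂ) ≠ 0 := by
    rw [Nat.cast_ne_zero]
    omega
  have h1 : LSeriesHasSum (fun n => if n = 1 then (1 : ℂ) else 0) s 1 := by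
    simpa using LSeriesHasSum_ite_eq one_ne_zero s
  have h2 : LSeriesHasSum (fun n => (dirichletMonomial p n : ℂ)) s ((p : ℂ) ^ (-s)) := by
    simp_rw [dirichletMonomial_apply hp]
    push_cast
    exact LSeriesHasSum_ite_eq (by omega) s
  have h3 := (LSeriesHasSum_intCast_mul h2 h2).smul (p : ℂ)
  have h4 := (h1.sub h2).add h3
  have e : (p : ℂ) ^ (1 - 2 * s) = (p : ℂ) * ((p : ℂ) ^ (-s) * (p : ℂ) ^ (-s)) := by
    rw [← Complex.cpow_add _ _ hp0, show 1 - 2 * s = 1 + (-s + -s) by ring,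
      Complex.cpow_add _ _ hp0, Complex.cpow_one]
  rw [e]
  convert h4 using 1
  ext n
  rw [localFactor_eq, ← nsmul_eq_mul, ArithmeticFunction.add_apply, sub_eq_add_neg,
    ArithmeticFunction.add_apply, ArithmeticFunction.nsmul_apply_int,
    show (-dirichletMonomial p) n = -(dirichletMonomial p n) from rfl,
    ArithmeticFunction.one_apply, pow_two]
  simp [sub_eq_add_neg]

theorem LSeriesHasSum_prod_localFactor_mul_zeta_pow {s : ℂ} (hs : 1 < s.re) :
    LSeriesHasSum (fun n => (((∏ p ∈ ({2, 3, 5} : Finset ℕ), localFactor p) *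
        (ArithmeticFunction.zeta : ArithmeticFunction ℤ) ^ 3) n : ℂ)) s
      ((∏ p ∈ ({2, 3, 5} : Finset ℕ), (1 - (p : ℂ) ^ (-s) + (p : ℂ) ^ (1 - 2 * s))) *
        riemannZeta s ^ 3) := by
  have hz : LSeriesHasSum (fun n => ((ArithmeticFunction.zeta : ArithmeticFunction ℤ) n : ℂ)) s
      (riemannZeta s) := by
    convert ArithmeticFunction.LSeriesHasSum_zeta hs using 1
    ext n
    simp
  rw [Finset.prod_insert (by decide), Finset.prod_insert (by decide), Finset.prod_singleton,
    Finset.prod_insert (by decide), Finset.prod_insert (by decide), Finset.prod_singleton,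
    pow_three, pow_three]
  exact LSeriesHasSum_intCast_mul (LSeriesHasSum_intCast_mul
      (LSeriesHasSum_localFactor (by norm_num) s) (LSeriesHasSum_intCast_mul
      (LSeriesHasSum_localFactor (by norm_num) s) (LSeriesHasSum_localFactor (by norm_num) s)))
    (LSeriesHasSum_intCast_mul hz (LSeriesHasSum_intCast_mul hz hz))

theorem mainTheorem7 {V : Type*} [Fintype V] [DecidableEq V]
    (G : SimpleGraph V) [DecidableRel G.Adj] (hG : Nonempty (G ≃g petersenGraph)) :
    -- the eigenvalues of the adjacency matrix
    spectrum ℂ (G.adjMatrix ℂ) = {3, 1, -2} ∧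
    -- the coefficients of the zeta function are well defined
    (∀ n : ℕ, 1 ≤ n → (idealsOfIndex (matrixOrder (G.adjMatrix ℤ)) n).Finite) ∧
    -- the identity of formal Dirichlet series
    idealZeta (matrixOrder (G.adjMatrix ℤ)) =
      (∏ p ∈ ({2, 3, 5} : Finset ℕ), localFactor p) *
        (ArithmeticFunction.zeta : ArithmeticFunction ℤ) ^ 3 ∧
    -- the identity of functions on the half-plane of absolute convergence
    (∀ s : ℂ, 1 < s.re →
      LSeriesHasSum (fun n => (idealZeta (matrixOrder (G.adjMatrix ℤ)) n : ℂ)) s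
        ((∏ p ∈ ({2, 3, 5} : Finset ℕ), (1 - (p : ℂ) ^ (-s) + (p : ℂ) ^ (1 - 2 * s))) *
          riemannZeta s ^ 3)) := by
  have hgen := mul_mem_of_shiftedGenerator_mul_mem hG
  have he := shiftedGenerator_mul_newtonCombination hG
  have hzeta := idealZeta_eq (shiftedGenerator G) (newtonEquiv hG) hgen he
  refine ⟨spectrum_adjMatrix hG, fun n hn => ?_, hzeta, fun s hs => ?_⟩
  · exact finite_idealsOfIndex (shiftedGenerator G) (newtonEquiv hG) hgen he (by omega)
  · rw [hzeta]
    exact LSeriesHasSum_prod_localFactor_mul_zeta_pow hs
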